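/- Let $\Sigma$ be a finite alphabet, let $M$ be a finite aperiodic monoid (there is $n$ with $x^n=x^{n+1}$ for all $x\in M$), and let $\varphi\colon\Sigma^*\to M$ be a monoid morphism. Then for every $s\in M$ there is a regular expression $E_s$ over $\Sigma$ (built from $\emptyset$, $\varepsilon$, letters $a\in\Sigma$, union, concatenation and Kleene star) with $L(E_s)=\varphi^{-1}(s)$ that has all of the following three properties. 1. $E_s$ is unambiguous: for each subexpression $E_1\cup E_2$ we have $L(E_1)\cap L(E_2)=\emptyset$; for each subexpression $E_1\cdot E_2$, every word $w\in L(E_1\cdot E_2)$ has a unique factorisation $w=uv$ with $u\in L(E_1)$ and $v\in L(E_2)$; and for each subexpression $E_1^*$, the language $L(E_1)$ is a code, that is, every word $w\in L(E_1^*)$ has a unique factorisation $w=v_1\cdots v_n$ with $n\ge 0$ and all $v_i\in L(E_1)$. 2. $E_s$ is $\varphi$-stabilising: for each subexpression $F^*$ of $E_s$, the set $X=\varphi(L(F))$ is stabilising, that is, there is $n\ge 1$ such that $xy=x$ for all $x\in X^n$ and all $y\in X$, where $X^n=\{x_1\cdots x_n \mid x_1,\dots,x_n\in X\}$. 3. $E_s$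 is SD-regular: for each subexpression $F^*$ of $E_s$, the language $C=L(F)$ is a prefix code (if $u,uv\in C$ then $v=\varepsilon$) with bounded synchronisation delay (there is $d\ge 1$ such that for all $u,v,w\in\Sigma^*$, if $uvw\in C^*$ and $v\in C^d$ then $uv\in C^*$). -/

import Mathlib

open scoped Pointwise Computability

/-- A monoid is aperiodic if a single exponent `n` satisfies `s ^ n = s ^ (n + 1)` for all `s`. -/
def Monoid.IsAperiodic (M : Type*) [Monoid M] : Prop :=
  ∃ n : ℕ, ∀ s : M, s ^ n = s ^ (n + 1)

/-- `X` is `n`-stabilising if `x * y = x` for all `x` in the `n`-fold product set `X ^ n` and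
all `y` in `X`. -/
def Set.IsNStabilising {M : Type*} [Monoid M] (n : ℕ) (X : Set M) : Prop :=
  ∀ x ∈ X ^ n, ∀ y ∈ X, x * y = x

/-- `X` is stabilising if it is `n`-stabilising for some `n ≥ 1`. -/
def Set.IsStabilising {M : Type*} [Monoid M] (X : Set M) : Prop :=
  ∃ n : ℕ, 1 ≤ n ∧ X.IsNStabilising n

namespace Language

/-- No word of `C` is a proper prefix of another word of `C`. -/
def IsPrefixCode {α : Type*} (C : Language α) : Prop :=
  ∀ u v : List α, u ∈ C → u ++ v ∈ C → v = []

/-- The synchronisation condition with delay `d`; `C ^ d` is the `d`-fold concatenation. -/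
def HasSyncDelay {α : Type*} (C : Language α) (d : ℕ) : Prop :=
  ∀ u v w : List α, u ++ v ++ w ∈ C∗ → v ∈ C ^ d → u ++ v ∈ C∗

/-- A prefix code with bounded synchronisation delay. -/
def IsSDPrefixCode {α : Type*} (C : Language α) : Prop :=
  C.IsPrefixCode ∧ ∃ d : ℕ, 1 ≤ d ∧ C.HasSyncDelay d

end Language

namespace RegularExpression

/-- The set of subexpressions of a regular expression, including the expression itself. -/
def subexpressions {α : Type*} : RegularExpression α → Set (RegularExpression α)
  | .zero => {.zero}
  | .epsilon => {.epsilon}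
  | .char a => {.char a}
  | .plus P Q => {.plus P Q} ∪ P.subexpressions ∪ Q.subexpressions
  | .comp P Q => {.comp P Q} ∪ P.subexpressions ∪ Q.subexpressions
  | .star P => {.star P} ∪ P.subexpressions

/-- The language of an expression, as a subset of the free monoid. -/
def lang {α : Type*} (E : RegularExpression α) : Set (FreeMonoid α) :=
  {w | w.toList ∈ E.matches'}

/-- Kleene star is applied only to expressions of SD prefix codes. -/
def IsSDRegular {α : Type*} (E : RegularExpression α) : Prop :=
  ∀ F : RegularExpression α, F.star ∈ E.subexpressions → F.matches'.IsSDPrefixCode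

/-- Unambiguity: unions are disjoint, factorisations in concatenations are unique, and starred
languages are codes. -/
structure IsUnambiguous {α : Type*} (E : RegularExpression α) : Prop where
  union : ∀ E₁ E₂ : RegularExpression α, E₁ + E₂ ∈ E.subexpressions →
    ∀ w : List α, ¬ (w ∈ E₁.matches' ∧ w ∈ E₂.matches')
  concat : ∀ E₁ E₂ : RegularExpression α, E₁ * E₂ ∈ E.subexpressions →
    ∀ w ∈ (E₁ * E₂).matches',
      ∃! p : List α × List α, p.1 ∈ E₁.matches' ∧ p.2 ∈ E₂.matches' ∧ w = p.1 ++ p.2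
  star : ∀ E₁ : RegularExpression α, E₁.star ∈ E.subexpressions →
    InformationTheory.UniquelyDecodable (E₁.matches' : Set (List α))

/-- For each starred subexpression `F.star` of `E`, the image of the language of `F` under `φ`
is a stabilising subset of `M`. -/
def IsStabilising {α M : Type*} [Monoid M] (φ : FreeMonoid α →* M)
    (E : RegularExpression α) : Prop :=
  ∀ F : RegularExpression α, F.star ∈ E.subexpressions → (φ '' F.lang).IsStabilising

end RegularExpression

/-! The method is that of local divisors: induction on |M| and, inside it, on the size of a
subalphabet B. If φ is trivial on B, then B* or ∅ will do. Otherwise pick c ∈ B with φ(c) ≠ 1 and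
let A = B \ {c}. A word over B either avoids c or splits uniquely after its last c. The part ending
in c is uniquely b₁c⋯bₖc with all bᵢ over A, and is read as the word φ(b₁)⋯φ(bₖ) over the alphabet
M. Up to a left factor φ(c), a product of blocks bᵢc is evaluated in the local divisor at φ(c)
(`mul_map_eq_val_sandwich`), which is aperiodic and smaller than M (`card_lt`). Induction supplies
expressions over the alphabet M; each letter t in them is replaced by an expression for φ⁻¹(t) ∩ A*
followed by c.

This substitution keeps all required properties (`IsAdmissible.subst`), because c marks the ends of
blocks. Unambiguity and prefix codes lift by unique parsing; synchronisation and stabilisation each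
cost one extra factor, which ends in c. -/

/-! ### Local divisors. -/

/-- The local divisor of `M` at `c`: the elements of `M * c ∩ c * M`. -/
def LocalDivisor {M : Type*} [Monoid M] (c : M) : Type _ :=
  {x : M // (∃ u, x = u * c) ∧ ∃ v, x = c * v}

namespace LocalDivisor

variable {M : Type*} [Monoid M] {c : M}

/-- The inclusion of a local divisor into the ambient monoid. -/
def val (x : LocalDivisor c) : M := Subtype.val x

theorem val_injective : Function.Injective (val : LocalDivisor c → M) := Subtype.val_injective

theorem exists_left (x : LocalDivisor c) : ∃ u, x.val = u * c := x.2.1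

theorem exists_right (x : LocalDivisor c) : ∃ v, x.val = c * v := x.2.2

/-- The product `(u * c) ∘ y = u * y`. -/
noncomputable instance : Mul (LocalDivisor c) where
  mul x y := ⟨x.exists_left.choose * y.val, by
    obtain ⟨u, hu⟩ := y.exists_left
    exact ⟨x.exists_left.choose * u, by rw [hu, mul_assoc]⟩, by
    obtain ⟨v, hv⟩ := y.exists_right
    obtain ⟨w, hw⟩ := x.exists_right
    refine ⟨w * v, ?_⟩
    rw [hv, ← mul_assoc, ← x.exists_left.choose_spec, hw, mul_assoc]⟩

theorem val_mul_eq_choose (x y : LocalDivisor c) :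
    (x * y).val = x.exists_left.choose * y.val := rfl

/-- Together with `val_mul_of_left`, this frees the product from the chosen representative: for x =
uc and y = cv it is ucv. -/
theorem val_mul_of_right (x y : LocalDivisor c) {v : M} (hv : y.val = c * v) :
    (x * y).val = x.val * v := by
  rw [val_mul_eq_choose, hv, ← mul_assoc, ← x.exists_left.choose_spec]

theorem val_mul_of_left (x y : LocalDivisor c) {u : M} (hu : x.val = u * c) :
    (x * y).val = u * y.val := by
  obtain ⟨v, hv⟩ := y.exists_right
  rw [val_mul_of_right x y hv, hu, hv, mul_assoc]

instance : One (LocalDivisor c) := ⟨⟨c, ⟨1, (one_mul c).symm⟩, ⟨1, (mul_one c).symm⟩⟩⟩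

theorem val_one : (1 : LocalDivisor c).val = c := rfl

noncomputable instance : Monoid (LocalDivisor c) where
  mul_assoc x y z := by
    apply val_injective
    obtain ⟨u, hu⟩ := x.exists_left
    obtain ⟨w, hw⟩ := z.exists_right
    rw [val_mul_of_right _ z hw, val_mul_of_left x _ hu, val_mul_of_left x _ hu,
      val_mul_of_right y z hw, mul_assoc]
  one_mul x := val_injective <| by
    rw [val_mul_of_left (u := 1) _ _ (by rw [val_one, one_mul]), one_mul]
  mul_one x := val_injective <| by
    rw [val_mul_of_right (v := 1) _ _ (by rw [val_one, mul_one]), mul_one]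

instance [Finite M] : Finite (LocalDivisor c) := Finite.of_injective val val_injective

theorem val_pow (x : LocalDivisor c) {v : M} (hv : x.val = c * v) (n : ℕ) :
    (x ^ n).val = c * v ^ n := by
  induction n with
  | zero => rw [pow_zero, pow_zero, mul_one, val_one]
  | succ n ih => rw [pow_succ, val_mul_of_right _ _ hv, ih, pow_succ, mul_assoc]

theorem isAperiodic (hM : Monoid.IsAperiodic M) : Monoid.IsAperiodic (LocalDivisor c) := by
  obtain ⟨n, hn⟩ := hM
  refine ⟨n, fun x => val_injective ?_⟩
  obtain ⟨v, hv⟩ := x.exists_right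
  rw [val_pow x hv, val_pow x hv, hn v]

/-- The element 1 is missing from the local divisor: 1 = uc gives uⁿcⁿ = 1, and then cⁿ = cⁿ⁺¹
forces c = 1. -/
theorem card_lt [Finite M] (hM : Monoid.IsAperiodic M) (hc : c ≠ 1) :
    Nat.card (LocalDivisor c) < Nat.card M := by
  rw [← Set.ncard_univ M, ← Nat.card_range_of_injective (val_injective (c := c)),
    Nat.card_coe_set_eq]
  refine Set.ncard_lt_ncard ((Set.ssubset_univ_iff).2 fun h => ?_)
  obtain ⟨x, hx⟩ : (1 : M) ∈ Set.range (val : LocalDivisor c → M) := h ▸ Set.mem_univ _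
  obtain ⟨u, hu⟩ := x.exists_left
  obtain ⟨n, hn⟩ := hM
  have huc : u * c = 1 := by rw [← hu, hx]
  have hpow : ∀ k : ℕ, u ^ k * c ^ k = 1 := fun k => by
    induction k with
    | zero => simp
    | succ k ih => rw [pow_succ, pow_succ', mul_assoc, ← mul_assoc u c, huc, one_mul, ih]
  refine hc ?_
  calc c = (u ^ n * c ^ n) * c := by rw [hpow, one_mul]
    _ = u ^ n * c ^ n := by rw [mul_assoc, ← pow_succ, ← hn]
    _ = 1 := hpow n

/-- The element `c * t * c` of the local divisor at `c`. -/
def between (c t : M) : LocalDivisor c := ⟨c * t * c, ⟨c * t, rfl⟩, ⟨t * c, mul_assoc _ _ _⟩⟩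

/-- The morphism from words over `M` to the local divisor sending the letter `t` to `c * t * c`. -/
noncomputable def sandwich (c : M) : FreeMonoid M →* LocalDivisor c :=
  FreeMonoid.lift (between c)

theorem val_sandwich_cons (t : M) (f : List M) :
    (sandwich c (FreeMonoid.ofList (t :: f))).val =
      c * t * (sandwich c (FreeMonoid.ofList f)).val := by
  rw [FreeMonoid.ofList_cons, map_mul, sandwich, FreeMonoid.lift_eval_of]
  exact val_mul_of_left _ _ rfl

end LocalDivisor

/-! ### Substitution of marked languages. -/

namespace Language

variable {α T : Type*}

/-- The words obtained from `f` by replacing each letter `t` by a word of `L t`. -/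
def encode (L : T → Language α) (f : List T) : Language α := (f.map L).prod

@[simp]
theorem mem_encode_nil {L : T → Language α} {w : List α} : w ∈ encode L [] ↔ w = [] := by
  simp [encode]

theorem encode_cons (L : T → Language α) (t : T) (f : List T) :
    encode L (t :: f) = L t * encode L f := by
  simp [encode]

theorem encode_append (L : T → Language α) (f g : List T) :
    encode L (f ++ g) = encode L f * encode L g := by
  simp [encode]

/-- The image of a language over `T` under the substitution `L`. -/
def subst (L : T → Language α) (K : Language T) : Language α :=
  {w | ∃ f ∈ K, w ∈ encode L f}

theorem mem_subst {L : T → Language α} {K : Language T} {w : List α} :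
    w ∈ subst L K ↔ ∃ f ∈ K, w ∈ encode L f := Iff.rfl

theorem subst_zero (L : T → Language α) : subst L 0 = 0 := by
  ext w; simp [mem_subst]

theorem subst_one (L : T → Language α) : subst L 1 = 1 := by
  ext w; simp [mem_subst]

theorem subst_singleton (L : T → Language α) (t : T) : subst L {[t]} = L t := by
  ext w
  rw [mem_subst]
  constructor
  · rintro ⟨f, rfl, hf⟩
    simpa [encode] using hf
  · intro h
    exact ⟨[t], rfl, by simpa [encode] using h⟩

theorem subst_add (L : T → Language α) (K K' : Language T) :
    subst L (K + K') = subst L K + subst L K' := by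
  ext w
  simp only [mem_subst, mem_add, or_and_right, exists_or]

theorem subst_mul (L : T → Language α) (K K' : Language T) :
    subst L (K * K') = subst L K * subst L K' := by
  ext w
  simp only [mem_subst, mem_mul]
  constructor
  · rintro ⟨_, ⟨f, hf, g, hg, rfl⟩, hw⟩
    rw [encode_append, mem_mul] at hw
    obtain ⟨a, ha, b, hb, rfl⟩ := hw
    exact ⟨a, ⟨f, hf, ha⟩, b, ⟨g, hg, hb⟩, rfl⟩
  · rintro ⟨a, ⟨f, hf, ha⟩, b, ⟨g, hg, hb⟩, rfl⟩
    exact ⟨f ++ g, ⟨f, hf, g, hg, rfl⟩, by rw [encode_append]; exact append_mem_mul ha hb⟩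

theorem subst_pow (L : T → Language α) (K : Language T) (n : ℕ) :
    subst L (K ^ n) = subst L K ^ n := by
  induction n with
  | zero => simp [subst_one]
  | succ n ih => rw [pow_succ, pow_succ, subst_mul, ih]

theorem subst_kstar (L : T → Language α) (K : Language T) :
    subst L K∗ = (subst L K)∗ := by
  ext w
  simp only [kstar_eq_iSup_pow, mem_iSup, ← subst_pow, mem_subst]
  constructor
  · rintro ⟨f, ⟨i, hi⟩, hw⟩
    exact ⟨i, f, hi, hw⟩
  · rintro ⟨i, f, hi, hw⟩
    exact ⟨f, ⟨i, hi⟩, hw⟩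

/-- The languages `L t` are pairwise disjoint and consist of words whose only occurrence of the
letter `c` is at the end. -/
structure IsMarked (c : α) (L : T → Language α) : Prop where
  exists_eq : ∀ t, ∀ w ∈ L t, ∃ b : List α, c ∉ b ∧ w = b ++ [c]
  eq_of_mem : ∀ t t', ∀ w ∈ L t, w ∈ L t' → t = t'

theorem append_marker_inj {c : α} {b b' x y : List α} (hb : c ∉ b) (hb' : c ∉ b')
    (h : b ++ [c] ++ x = b' ++ [c] ++ y) : b = b' ∧ x = y := by
  induction b generalizing b' with
  | nil =>
    cases b' with
    | nil => simpa using h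
    | cons a b' => simp at h hb'; exact absurd h.1 hb'.1
  | cons a b ih =>
    cases b' with
    | nil => simp at h hb; exact absurd h.1.symm hb.1
    | cons a' b' =>
      simp only [List.cons_append, List.cons.injEq, List.mem_cons, not_or] at h hb hb'
      obtain ⟨rfl, rfl⟩ := ih hb.2 hb'.2 h.2
      simp [h.1]

namespace IsMarked

variable {c : α} {L : T → Language α}

theorem eq_of_append (hL : IsMarked c L) {t t' : T} {w w' x y : List α} (hw : w ∈ L t)
    (hw' : w' ∈ L t') (h : w ++ x = w' ++ y) : t = t' ∧ w = w' ∧ x = y := by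
  obtain ⟨b, hb, rfl⟩ := hL.exists_eq t w hw
  obtain ⟨b', hb', rfl⟩ := hL.exists_eq t' w' hw'
  obtain ⟨rfl, rfl⟩ := append_marker_inj hb hb' h
  exact ⟨hL.eq_of_mem _ _ _ hw hw', rfl, rfl⟩

theorem ne_nil_of_mem (hL : IsMarked c L) {t : T} {w : List α} (hw : w ∈ L t) : w ≠ [] := by
  obtain ⟨b, -, rfl⟩ := hL.exists_eq t w hw
  simp

theorem eq_nil_of_nil_mem_encode (hL : IsMarked c L) {f : List T} (h : [] ∈ encode L f) :
    f = [] := by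
  cases f with
  | nil => rfl
  | cons t f =>
    rw [encode_cons, mem_mul] at h
    obtain ⟨a, ha, b, -, hab⟩ := h
    exact absurd (List.append_eq_nil_iff.1 hab).1 (hL.ne_nil_of_mem ha)

/-- The first occurrence of c determines the first block, and disjointness of the `L t` its letter,
so parsing from the left is deterministic. -/
theorem exists_eq_append_of_prefix (hL : IsMarked c L) {f g : List T} {w v : List α}
    (hw : w ∈ encode L f) (hwv : w ++ v ∈ encode L g) : ∃ h, g = f ++ h ∧ v ∈ encode L h := by
  induction f generalizing g w with
  | nil =>
    rw [mem_encode_nil] at hw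
    subst hw
    exact ⟨g, rfl, hwv⟩
  | cons t f ih =>
    rw [encode_cons, mem_mul] at hw
    obtain ⟨a, ha, b, hb, rfl⟩ := hw
    cases g with
    | nil =>
      rw [mem_encode_nil] at hwv
      simp [hL.ne_nil_of_mem ha] at hwv
    | cons t' g =>
      rw [encode_cons, mem_mul] at hwv
      obtain ⟨a', ha', b', hb', h⟩ := hwv
      rw [List.append_assoc] at h
      obtain ⟨rfl, rfl, rfl⟩ := hL.eq_of_append ha' ha h
      obtain ⟨h, rfl, hv⟩ := ih hb hb'
      exact ⟨h, rfl, hv⟩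

theorem encode_inj (hL : IsMarked c L) {f g : List T} {w : List α} (hf : w ∈ encode L f)
    (hg : w ∈ encode L g) : f = g := by
  obtain ⟨h, rfl, hh⟩ := hL.exists_eq_append_of_prefix (v := []) hf (by simpa using hg)
  simp [hL.eq_nil_of_nil_mem_encode hh]

theorem eq_of_append_encode (hL : IsMarked c L) {f : List T} {p q x y : List α}
    (hp : p ∈ encode L f) (hq : q ∈ encode L f) (h : p ++ x = q ++ y) : p = q ∧ x = y := by
  induction f generalizing p q with
  | nil =>
    rw [mem_encode_nil] at hp hq
    subst hp hq
    exact ⟨rfl, h⟩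
  | cons t f ih =>
    rw [encode_cons, mem_mul] at hp hq
    obtain ⟨a, ha, b, hb, rfl⟩ := hp
    obtain ⟨a', ha', b', hb', rfl⟩ := hq
    rw [List.append_assoc, List.append_assoc] at h
    obtain ⟨-, rfl, h'⟩ := hL.eq_of_append ha ha' h
    obtain ⟨rfl, rfl⟩ := ih hb hb' h'
    exact ⟨rfl, rfl⟩

theorem exists_eq_append_marker (hL : IsMarked c L) {f : List T} {w : List α} (hf : f ≠ [])
    (hw : w ∈ encode L f) : ∃ b, w = b ++ [c] := by
  obtain ⟨g, t, rfl⟩ := List.eq_nil_or_concat' f |>.resolve_left hf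
  rw [encode_append, mem_mul] at hw
  obtain ⟨a, -, b, hb, rfl⟩ := hw
  rw [encode_cons, mem_mul] at hb
  obtain ⟨x, hx, y, hy, rfl⟩ := hb
  rw [mem_encode_nil] at hy
  obtain ⟨b, -, rfl⟩ := hL.exists_eq _ _ hx
  exact ⟨a ++ b, by simp [hy]⟩

/-- Every occurrence of c ends a block, so a cut just after c respects the parsing. -/
theorem exists_append_encode (hL : IsMarked c L) {g : List T} {u v : List α}
    (h : u ++ [c] ++ v ∈ encode L g) :
    ∃ g₁ g₂, g = g₁ ++ g₂ ∧ u ++ [c] ∈ encode L g₁ ∧ v ∈ encode L g₂ := by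
  induction g generalizing u with
  | nil => simp at h
  | cons t g ih =>
    rw [encode_cons, mem_mul] at h
    obtain ⟨a, ha, w, hw, h⟩ := h
    obtain ⟨b, hb, rfl⟩ := hL.exists_eq _ _ ha
    -- If c occurs in `u`, the first block lies inside `u` and is peeled off; otherwise the
    -- displayed c ends the first block.
    by_cases hu : c ∈ u
    · obtain ⟨b', u', rfl, hb'⟩ := List.eq_append_cons_of_mem hu
      have h' : b ++ [c] ++ w = b' ++ [c] ++ (u' ++ [c] ++ v) := by simpa using h
      obtain ⟨rfl, rfl⟩ := append_marker_inj hb hb' h'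
      obtain ⟨g₁, g₂, rfl, h₁, h₂⟩ := ih hw
      refine ⟨t :: g₁, g₂, rfl, ?_, h₂⟩
      rw [encode_cons, mem_mul]
      exact ⟨b ++ [c], ha, _, h₁, by simp⟩
    · obtain ⟨rfl, rfl⟩ := append_marker_inj hb hu h
      refine ⟨[t], g, rfl, ?_, hw⟩
      rw [encode_cons, mem_mul]
      exact ⟨_, ha, [], by simp, by simp⟩

theorem subst_isPrefixCode (hL : IsMarked c L) {K : Language T} (hK : K.IsPrefixCode) :
    (subst L K).IsPrefixCode := by
  rintro u v ⟨f, hf, hu⟩ ⟨g, hg, huv⟩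
  obtain ⟨h, rfl, hv⟩ := hL.exists_eq_append_of_prefix hu huv
  obtain rfl := hK f h hf hg
  simpa using hv

theorem nil_notMem_subst (hL : IsMarked c L) {K : Language T} (hK : [] ∉ K) :
    [] ∉ subst L K := by
  rintro ⟨f, hf, h⟩
  rw [hL.eq_nil_of_nil_mem_encode h] at hf
  exact hK hf

/-- The first of the d + 1 factors is spent on reaching a c, hence a block boundary; from there the
other d factors decode to a word of `K ^ d`, and the delay of `K` applies. -/
theorem subst_hasSyncDelay (hL : IsMarked c L) {K : Language T} (hK : [] ∉ K) {d : ℕ}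
    (hd : K.HasSyncDelay d) : (subst L K).HasSyncDelay (d + 1) := by
  intro u v w huvw hv
  rw [pow_succ', ← subst_pow, mem_mul] at hv
  obtain ⟨a, ⟨f, hf, ha⟩, b, ⟨g, hg, hb⟩, rfl⟩ := hv
  rw [← subst_kstar] at huvw ⊢
  obtain ⟨k, hk, huvw⟩ := huvw
  have hf0 : f ≠ [] := fun h => hK (h ▸ hf)
  obtain ⟨a, rfl⟩ := hL.exists_eq_append_marker hf0 ha
  have h₁ : (u ++ a) ++ [c] ++ (b ++ w) ∈ encode L k := by simpa using huvw
  obtain ⟨k₁, k₂, rfl, hk₁, hk₂⟩ := hL.exists_append_encode h₁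
  obtain ⟨k₃, rfl, hk₃⟩ := hL.exists_eq_append_of_prefix hb hk₂
  refine ⟨k₁ ++ g, hd k₁ g k₃ (by simpa using hk) hg, ?_⟩
  rw [encode_append, mem_mul]
  exact ⟨_, hk₁, b, hb, by simp⟩

end IsMarked

/-- The hypothesis on the empty word is needed: {ε} satisfies `IsPrefixCode` but is not a code. -/
theorem IsPrefixCode.uniquelyDecodable {C : Language α} (hC : C.IsPrefixCode) (h : [] ∉ C) :
    InformationTheory.UniquelyDecodable (C : Set (List α)) := by
  intro L₁
  induction L₁ with
  | nil =>
    rintro (_ | ⟨w, L₂⟩) - h₂ hflat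
    · rfl
    · have hw : w = [] := (List.append_eq_nil_iff.1 hflat.symm).1
      exact absurd (hw ▸ h₂ w (by simp)) h
  | cons v L₁ ih =>
    rintro (_ | ⟨w, L₂⟩) h₁ h₂ hflat
    · have hv : v = [] := (List.append_eq_nil_iff.1 hflat).1
      exact absurd (hv ▸ h₁ v (by simp)) h
    · have hv : v ∈ C := h₁ v (by simp)
      have hw : w ∈ C := h₂ w (by simp)
      rw [List.flatten_cons, List.flatten_cons] at hflat
      have hvw : v = w := by
        rcases List.append_eq_append_iff.1 hflat with ⟨a, rfl, -⟩ | ⟨a, rfl, -⟩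
        · simp [hC _ _ hv hw]
        · simp [hC _ _ hw hv]
      subst hvw
      rw [ih L₂ (fun x hx => h₁ x (by simp [hx])) (fun x hx => h₂ x (by simp [hx]))
        (List.append_cancel_left hflat)]

end Language

/-! ### Admissible expressions and their substitution. -/

namespace RegularExpression

variable {α T M N : Type*} [Monoid M] [Monoid N]

/-- A recursive form of the conjunction of unambiguity, SD-regularity and the stabilising
property. -/
def IsAdmissible (φ : FreeMonoid α →* M) : RegularExpression α → Prop
  | .zero => True
  | .epsilon => True
  | .char _ => True
  | .plus P Q => IsAdmissible φ P ∧ IsAdmissible φ Q ∧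
      ∀ w, ¬ (w ∈ P.matches' ∧ w ∈ Q.matches')
  | .comp P Q => IsAdmissible φ P ∧ IsAdmissible φ Q ∧
      ∀ p ∈ P.matches', ∀ p' ∈ P.matches', ∀ q ∈ Q.matches', ∀ q' ∈ Q.matches',
        p ++ q = p' ++ q' → p = p' ∧ q = q'
  | .star P => IsAdmissible φ P ∧ P.matches'.IsSDPrefixCode ∧ [] ∉ P.matches' ∧
      (φ '' P.lang).IsStabilising

theorem IsAdmissible.of_mem_subexpressions {φ : FreeMonoid α →* M} {E F : RegularExpression α}
    (hE : E.IsAdmissible φ) (hF : F ∈ E.subexpressions) : F.IsAdmissible φ := by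
  induction E with
  | zero => obtain rfl := hF; trivial
  | epsilon => obtain rfl := hF; trivial
  | char a => obtain rfl := hF; trivial
  | plus P Q ihP ihQ =>
    rcases hF with (rfl | hF) | hF
    exacts [hE, ihP hE.1 hF, ihQ hE.2.1 hF]
  | comp P Q ihP ihQ =>
    rcases hF with (rfl | hF) | hF
    exacts [hE, ihP hE.1 hF, ihQ hE.2.1 hF]
  | star P ihP =>
    rcases hF with rfl | hF
    exacts [hE, ihP hE.1 hF]

theorem IsAdmissible.isUnambiguous {φ : FreeMonoid α →* M} {E : RegularExpression α}
    (hE : E.IsAdmissible φ) : E.IsUnambiguous where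
  union _ _ h := (hE.of_mem_subexpressions h).2.2
  concat E₁ E₂ h w hw := by
    have huniq := (hE.of_mem_subexpressions h).2.2
    obtain ⟨a, ha, b, hb, rfl⟩ := Language.mem_mul.1 hw
    refine ⟨(a, b), ⟨ha, hb, rfl⟩, ?_⟩
    rintro ⟨a', b'⟩ ⟨ha', hb', hab⟩
    obtain ⟨rfl, rfl⟩ := huniq a ha a' ha' b hb b' hb' hab
    rfl
  star _ h :=
    have h' := hE.of_mem_subexpressions h
    h'.2.1.1.uniquelyDecodable h'.2.2.1

theorem IsAdmissible.isStabilising {φ : FreeMonoid α →* M} {E : RegularExpression α}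
    (hE : E.IsAdmissible φ) : E.IsStabilising φ :=
  fun _ h => (hE.of_mem_subexpressions h).2.2.2

theorem IsAdmissible.isSDRegular {φ : FreeMonoid α →* M} {E : RegularExpression α}
    (hE : E.IsAdmissible φ) : E.IsSDRegular :=
  fun _ h => (hE.of_mem_subexpressions h).2.1

theorem exists_of_mem_image_lang_pow {φ : FreeMonoid α →* M} {P : RegularExpression α} {n : ℕ}
    {x : M} (hx : x ∈ (φ '' P.lang) ^ n) :
    ∃ w ∈ P.matches' ^ n, φ (FreeMonoid.ofList w) = x := by
  induction n generalizing x with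
  | zero =>
    rw [pow_zero, Set.mem_one] at hx
    exact ⟨[], by simp, by simp [hx]⟩
  | succ n ih =>
    rw [pow_succ, Set.mem_mul] at hx
    obtain ⟨y, hy, _, ⟨w, hw, rfl⟩, rfl⟩ := hx
    obtain ⟨v, hv, rfl⟩ := ih hy
    refine ⟨v ++ w.toList, ?_, by rw [FreeMonoid.ofList_append, map_mul]; rfl⟩
    rw [pow_succ]
    exact Language.append_mem_mul hv hw

theorem image_mem_image_lang_pow {φ : FreeMonoid α →* M} {P : RegularExpression α} {n : ℕ}
    {w : List α} (hw : w ∈ P.matches' ^ n) :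
    φ (FreeMonoid.ofList w) ∈ (φ '' P.lang) ^ n := by
  induction n generalizing w with
  | zero =>
    rw [pow_zero, Language.mem_one] at hw
    simp [hw]
  | succ n ih =>
    rw [pow_succ, Language.mem_mul] at hw
    obtain ⟨a, ha, b, hb, rfl⟩ := hw
    rw [FreeMonoid.ofList_append, map_mul, pow_succ]
    exact Set.mul_mem_mul (ih ha) ⟨_, hb, rfl⟩

/-- Replace each letter `t` by the expression `σ t`. -/
def subst (σ : T → RegularExpression α) : RegularExpression T → RegularExpression α
  | .zero => .zero
  | .epsilon => .epsilon
  | .char t => σ t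
  | .plus P Q => .plus (subst σ P) (subst σ Q)
  | .comp P Q => .comp (subst σ P) (subst σ Q)
  | .star P => .star (subst σ P)

theorem matches'_subst (σ : T → RegularExpression α) (E : RegularExpression T) :
    (E.subst σ).matches' = Language.subst (fun t => (σ t).matches') E.matches' := by
  induction E with
  | zero => exact (Language.subst_zero _).symm
  | epsilon => exact (Language.subst_one _).symm
  | char t => exact (Language.subst_singleton (fun t => (σ t).matches') t).symm
  | plus P Q ihP ihQ =>
    exact (congrArg₂ (· + ·) ihP ihQ).trans (Language.subst_add _ _ _).symm
  | comp P Q ihP ihQ =>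
    exact (congrArg₂ (· * ·) ihP ihQ).trans (Language.subst_mul _ _ _).symm
  | star P ihP => exact (congrArg KStar.kstar ihP).trans (Language.subst_kstar _ _).symm

/-- The images under φ are controlled by ψ only behind a factor φ(c). One extra factor on the left
supplies it, since a nonempty product of blocks ends in c. -/
theorem isStabilising_subst {φ : FreeMonoid α →* M} {ψ : FreeMonoid T →* N} {ι : N → M} {c : α}
    {σ : T → RegularExpression α} (hL : Language.IsMarked c fun t => (σ t).matches')
    (hι : ∀ f w, w ∈ Language.encode (fun t => (σ t).matches') f →
      φ (FreeMonoid.of c) * φ (FreeMonoid.ofList w) = ι (ψ (FreeMonoid.ofList f)))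
    {P : RegularExpression T} (hP : [] ∉ P.matches') (hst : (ψ '' P.lang).IsStabilising) :
    (φ '' (P.subst σ).lang).IsStabilising := by
  obtain ⟨n, -, hn⟩ := hst
  refine ⟨n + 1, by omega, ?_⟩
  rintro x hx _ ⟨w₂, hw₂, rfl⟩
  rw [pow_succ', Set.mem_mul] at hx
  obtain ⟨_, ⟨w₀, hw₀, rfl⟩, x, hx, rfl⟩ := hx
  obtain ⟨w₁, hw₁, rfl⟩ := exists_of_mem_image_lang_pow hx
  change w₀.toList ∈ (P.subst σ).matches' at hw₀
  change w₂.toList ∈ (P.subst σ).matches' at hw₂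
  rw [matches'_subst] at hw₀ hw₁ hw₂
  rw [← Language.subst_pow] at hw₁
  obtain ⟨f₀, hf₀, hw₀⟩ := hw₀
  obtain ⟨f₁, hf₁, hw₁⟩ := hw₁
  obtain ⟨f₂, hf₂, hw₂⟩ := hw₂
  obtain ⟨z, hz⟩ := hL.exists_eq_append_marker (fun h => hP (h ▸ hf₀)) hw₀
  have hφ : φ w₀ = φ (FreeMonoid.ofList z) * φ (FreeMonoid.of c) := by
    rw [← map_mul]
    exact congrArg (fun l => φ (FreeMonoid.ofList l)) hz
  have h₁ := hι f₁ w₁ hw₁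
  have h₁₂ := hι (f₁ ++ f₂) (w₁ ++ w₂.toList)
    (by rw [Language.encode_append]; exact Language.append_mem_mul hw₁ hw₂)
  rw [FreeMonoid.ofList_append, FreeMonoid.ofList_append, map_mul, map_mul,
    hn _ (image_mem_image_lang_pow hf₁) _ ⟨FreeMonoid.ofList f₂, hf₂, rfl⟩, ← h₁,
    FreeMonoid.ofList_toList] at h₁₂
  rw [hφ, mul_assoc, mul_assoc, mul_assoc, h₁₂]

theorem IsAdmissible.subst {φ : FreeMonoid α →* M} {ψ : FreeMonoid T →* N} {ι : N → M} {c : α}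
    {σ : T → RegularExpression α} (hσ : ∀ t, (σ t).IsAdmissible φ)
    (hL : Language.IsMarked c fun t => (σ t).matches')
    (hι : ∀ f w, w ∈ Language.encode (fun t => (σ t).matches') f →
      φ (FreeMonoid.of c) * φ (FreeMonoid.ofList w) = ι (ψ (FreeMonoid.ofList f)))
    {E : RegularExpression T} (hE : E.IsAdmissible ψ) : (E.subst σ).IsAdmissible φ := by
  induction E with
  | zero => trivial
  | epsilon => trivial
  | char t => exact hσ t
  | plus P Q ihP ihQ =>
    refine ⟨ihP hE.1, ihQ hE.2.1, ?_⟩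
    rintro w ⟨hP, hQ⟩
    rw [matches'_subst] at hP hQ
    obtain ⟨f, hf, hwf⟩ := hP
    obtain ⟨g, hg, hwg⟩ := hQ
    exact hE.2.2 f ⟨hf, hL.encode_inj hwf hwg ▸ hg⟩
  | comp P Q ihP ihQ =>
    refine ⟨ihP hE.1, ihQ hE.2.1, ?_⟩
    rw [matches'_subst, matches'_subst]
    rintro p ⟨f, hf, hp⟩ p' ⟨f', hf', hp'⟩ q ⟨g, hg, hq⟩ q' ⟨g', hg', hq'⟩ h
    have h₁ := Language.append_mem_mul hp hq
    have h₂ := Language.append_mem_mul hp' hq'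
    rw [← Language.encode_append] at h₁ h₂
    obtain ⟨rfl, rfl⟩ := hE.2.2 f hf f' hf' g hg g' hg' (hL.encode_inj h₁ (h ▸ h₂))
    exact hL.eq_of_append_encode hp hp' h
  | star P ihP =>
    obtain ⟨hP, ⟨hpre, d, -, hd⟩, hnil, hst⟩ := hE
    refine ⟨ihP hP, ?_, ?_, isStabilising_subst hL hι hnil hst⟩
    · rw [matches'_subst]
      exact ⟨hL.subst_isPrefixCode hpre, d + 1, by omega, hL.subst_hasSyncDelay hnil hd⟩
    · rw [matches'_subst]
      exact hL.nil_notMem_subst hnil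

end RegularExpression

/-! ### Expressible languages and the case of trivial letters. -/

namespace Language

variable {α M : Type*} [Monoid M]

/-- A language is expressible if it is the language of an admissible expression. -/
def IsExpressible (φ : FreeMonoid α →* M) (K : Language α) : Prop :=
  ∃ E : RegularExpression α, E.IsAdmissible φ ∧ E.matches' = K

/-- The union of the languages `K i` for `i ∈ s`. -/
def biUnion {I : Type*} (s : Set I) (K : I → Language α) : Language α := {w | ∃ i ∈ s, w ∈ K i}

theorem mem_biUnion {I : Type*} {s : Set I} {K : I → Language α} {w : List α} :
    w ∈ biUnion s K ↔ ∃ i ∈ s, w ∈ K i := Iff.rfl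

theorem isExpressible_biUnion (φ : FreeMonoid α →* M) {I : Type*} (s : Set I)
    (hs : s.Finite) (K : I → Language α) (hK : ∀ i, (K i).IsExpressible φ)
    (hdisj : ∀ i j w, w ∈ K i → w ∈ K j → i = j) :
    (biUnion s K).IsExpressible φ := by
  induction s, hs using Set.Finite.induction_on with
  | empty =>
    refine ⟨.zero, trivial, ?_⟩
    ext w
    change False ↔ ∃ i ∈ (∅ : Set I), w ∈ K i
    simp
  | @insert i s his _ ih =>
    obtain ⟨P, hP, hPK⟩ := hK i
    obtain ⟨Q, hQ, hQK⟩ := ih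
    refine ⟨.plus P Q, ⟨hP, hQ, ?_⟩, ?_⟩
    · rw [hPK, hQK]
      rintro w ⟨hw, j, hj, hw'⟩
      exact his (hdisj i j w hw hw' ▸ hj)
    · ext w
      change w ∈ P.matches' ∨ w ∈ Q.matches' ↔ ∃ j ∈ insert i s, w ∈ K j
      rw [hPK, hQK]
      simp only [Set.mem_insert_iff, exists_eq_or_imp]
      rfl

theorem IsExpressible.mul {φ : FreeMonoid α →* M} {K K' : Language α}
    (hK : K.IsExpressible φ) (hK' : K'.IsExpressible φ)
    (huniq : ∀ p ∈ K, ∀ p' ∈ K, ∀ q ∈ K', ∀ q' ∈ K', p ++ q = p' ++ q' → p = p' ∧ q = q') :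
    (K * K').IsExpressible φ := by
  obtain ⟨P, hP, rfl⟩ := hK
  obtain ⟨Q, hQ, rfl⟩ := hK'
  exact ⟨.comp P Q, ⟨hP, hQ, huniq⟩, rfl⟩

theorem IsExpressible.add {φ : FreeMonoid α →* M} {K K' : Language α}
    (hK : K.IsExpressible φ) (hK' : K'.IsExpressible φ) (hdisj : ∀ w, ¬ (w ∈ K ∧ w ∈ K')) :
    (K + K').IsExpressible φ := by
  obtain ⟨P, hP, rfl⟩ := hK
  obtain ⟨Q, hQ, rfl⟩ := hK'
  exact ⟨.plus P Q, ⟨hP, hQ, hdisj⟩, rfl⟩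

theorem isExpressible_singleton (φ : FreeMonoid α →* M) (a : α) :
    IsExpressible φ {[a]} :=
  ⟨.char a, trivial, rfl⟩

/-- The words over the letters in `B` with image `s` under `φ`. -/
def fiberOver (φ : FreeMonoid α →* M) (B : Set α) (s : M) : Language α :=
  {w | (∀ a ∈ w, a ∈ B) ∧ φ (FreeMonoid.ofList w) = s}

theorem mem_fiberOver {φ : FreeMonoid α →* M} {B : Set α} {s : M} {w : List α} :
    w ∈ fiberOver φ B s ↔ (∀ a ∈ w, a ∈ B) ∧ φ (FreeMonoid.ofList w) = s := Iff.rfl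

/-- The one-letter words with letter in `B`. -/
def letters (B : Set α) : Language α := {w | ∃ a ∈ B, w = [a]}

theorem mem_kstar_letters {B : Set α} {w : List α} :
    w ∈ (letters B)∗ ↔ ∀ a ∈ w, a ∈ B := by
  constructor
  · rintro ⟨L, rfl, hL⟩ a ha
    obtain ⟨l, hl, ha⟩ := List.mem_flatten.1 ha
    obtain ⟨b, hb, rfl⟩ := hL l hl
    rw [List.mem_singleton] at ha
    exact ha ▸ hb
  · intro h
    refine ⟨w.map fun a => [a], (List.flatMap_singleton' w).symm.trans List.flatMap_def,
      fun y hy => ?_⟩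
    obtain ⟨a, ha, rfl⟩ := List.mem_map.1 hy
    exact ⟨a, h a ha, rfl⟩

theorem letters_isSDPrefixCode (B : Set α) : (letters B).IsSDPrefixCode := by
  refine ⟨?_, 1, le_rfl, ?_⟩
  · rintro _ v ⟨a, -, rfl⟩ ⟨b, -, hb⟩
    simpa using congrArg List.length hb
  · intro u v w huvw _
    rw [mem_kstar_letters] at huvw ⊢
    exact fun a ha => huvw a (List.mem_append_left _ ha)

theorem ofList_eq_one {φ : FreeMonoid α →* M} {B : Set α}
    (hB : ∀ a ∈ B, φ (FreeMonoid.of a) = 1) {w : List α} (hw : ∀ a ∈ w, a ∈ B) :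
    φ (FreeMonoid.ofList w) = 1 := by
  induction w with
  | nil => simp
  | cons a w ih =>
    rw [FreeMonoid.ofList_cons, map_mul, hB a (hw a (by simp)),
      ih fun b hb => hw b (by simp [hb]), one_mul]

theorem isExpressible_fiberOver_of_trivial [Finite α] (φ : FreeMonoid α →* M) {B : Set α}
    (hB : ∀ a ∈ B, φ (FreeMonoid.of a) = 1) (s : M) : (fiberOver φ B s).IsExpressible φ := by
  by_cases hs : s = 1
  · subst hs
    obtain ⟨E, hE, hEB⟩ := isExpressible_biUnion φ B B.toFinite (fun a => {[a]})
      (isExpressible_singleton φ) (by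
        rintro a b w rfl h
        exact List.singleton_injective h)
    have hEB : E.matches' = letters B := hEB
    refine ⟨.star E, ⟨hE, hEB ▸ letters_isSDPrefixCode B, ?_, 1, le_rfl, ?_⟩, ?_⟩
    · rw [hEB]
      rintro ⟨a, -, h⟩
      simp at h
    · rintro x - _ ⟨w, hw, rfl⟩
      change w.toList ∈ E.matches' at hw
      rw [hEB] at hw
      obtain ⟨a, ha, hw⟩ := hw
      have : φ w = φ (FreeMonoid.of a) := congrArg (fun l => φ (FreeMonoid.ofList l)) hw
      rw [this, hB a ha, mul_one]
    · change E.matches'∗ = _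
      rw [hEB]
      ext w
      rw [mem_kstar_letters, mem_fiberOver]
      exact ⟨fun h => ⟨h, ofList_eq_one hB h⟩, And.left⟩
  · refine ⟨.zero, trivial, ?_⟩
    ext w
    change False ↔ _
    rw [false_iff, mem_fiberOver]
    rintro ⟨h, rfl⟩
    exact hs (ofList_eq_one hB h)

end Language

/-! ### Splitting at a letter, and the two inductions. -/

namespace Language

variable {α M : Type*} [Monoid M]

theorem append_marker_inj_right {c : α} {x y b b' : List α} (hb : c ∉ b) (hb' : c ∉ b')
    (h : x ++ [c] ++ b = y ++ [c] ++ b') : x = y ∧ b = b' := by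
  have h' := congrArg List.reverse h
  simp only [List.reverse_append, List.reverse_singleton, ← List.append_assoc] at h'
  obtain ⟨h₁, h₂⟩ := append_marker_inj (by simpa using hb) (by simpa using hb') h'
  exact ⟨List.reverse_injective h₂, List.reverse_injective h₁⟩

/-- The words over the letters in `B` that have image `t` and are followed by a single `c`. -/
def markedFiber (φ : FreeMonoid α →* M) (B : Set α) (c : α) (t : M) : Language α :=
  fiberOver φ B t * {[c]}

theorem mem_markedFiber {φ : FreeMonoid α →* M} {B : Set α} {c : α} {t : M} {w : List α} :
    w ∈ markedFiber φ B c t ↔ ∃ b ∈ fiberOver φ B t, w = b ++ [c] := by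
  rw [markedFiber, mem_mul]
  constructor
  · rintro ⟨b, hb, _, rfl, rfl⟩
    exact ⟨b, hb, rfl⟩
  · rintro ⟨b, hb, rfl⟩
    exact ⟨b, hb, [c], rfl, rfl⟩

theorem isMarked_markedFiber (φ : FreeMonoid α →* M) {B : Set α} {c : α} (hc : c ∉ B) :
    IsMarked c (markedFiber φ B c) where
  exists_eq t w hw := by
    obtain ⟨b, hb, rfl⟩ := mem_markedFiber.1 hw
    exact ⟨b, fun h => hc (hb.1 c h), rfl⟩
  eq_of_mem t t' w hw hw' := by
    obtain ⟨b, hb, rfl⟩ := mem_markedFiber.1 hw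
    obtain ⟨b', hb', h⟩ := mem_markedFiber.1 hw'
    obtain rfl := List.append_cancel_right h
    exact hb.2.symm.trans hb'.2

/-- In the product of the elements φ(c)tφ(c), neighbours share one φ(c), just as consecutive blocks
share a c; the leading φ(c) completes the first block. -/
theorem mul_map_eq_val_sandwich (φ : FreeMonoid α →* M) {B : Set α} {c : α} {f : List M}
    {w : List α} (hw : w ∈ encode (markedFiber φ B c) f) :
    φ (FreeMonoid.of c) * φ (FreeMonoid.ofList w) =
      (LocalDivisor.sandwich (φ (FreeMonoid.of c)) (FreeMonoid.ofList f)).val := by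
  induction f generalizing w with
  | nil =>
    rw [mem_encode_nil] at hw
    subst hw
    rw [FreeMonoid.ofList_nil, FreeMonoid.ofList_nil, map_one, map_one, mul_one,
      LocalDivisor.val_one]
  | cons t f ih =>
    rw [encode_cons, mem_mul] at hw
    obtain ⟨a, ha, w, hw, rfl⟩ := hw
    obtain ⟨b, hb, rfl⟩ := mem_markedFiber.1 ha
    rw [LocalDivisor.val_sandwich_cons, ← ih hw, FreeMonoid.ofList_append,
      FreeMonoid.ofList_append, FreeMonoid.ofList_singleton, map_mul, map_mul, hb.2]
    simp only [mul_assoc]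

theorem forall_mem_of_mem_encode {φ : FreeMonoid α →* M} {B : Set α} {c : α} {f : List M}
    {w : List α} (hw : w ∈ encode (markedFiber φ B c) f) : ∀ a ∈ w, a ∈ insert c B := by
  induction f generalizing w with
  | nil =>
    rw [mem_encode_nil] at hw
    simp [hw]
  | cons t f ih =>
    rw [encode_cons, mem_mul] at hw
    obtain ⟨a, ha, w, hw, rfl⟩ := hw
    obtain ⟨b, hb, rfl⟩ := mem_markedFiber.1 ha
    intro x hx
    simp only [List.mem_append, List.mem_singleton] at hx
    rcases hx with (hx | rfl) | hx
    exacts [Or.inr (hb.1 x hx), Or.inl rfl, ih hw x hx]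

theorem exists_mem_encode_cons (φ : FreeMonoid α →* M) {B : Set α} {c : α} {u : List α}
    (hu : ∀ a ∈ u, a ∈ insert c B) :
    ∃ t f, u ++ [c] ∈ encode (markedFiber φ B c) (t :: f) := by
  induction u with
  | nil =>
    refine ⟨1, [], ?_⟩
    rw [encode_cons, mem_mul]
    exact ⟨[c], mem_markedFiber.2 ⟨[], ⟨by simp, by simp⟩, rfl⟩, [], by simp, rfl⟩
  | cons a u ih =>
    obtain ⟨t, f, h⟩ := ih fun b hb => hu b (by simp [hb])
    -- A letter c opens a new block with empty body, of image 1; any other letter extends the first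
    -- block.
    rcases hu a (by simp) with rfl | ha
    · refine ⟨1, t :: f, ?_⟩
      rw [encode_cons, mem_mul]
      exact ⟨[a], mem_markedFiber.2 ⟨[], ⟨by simp, by simp⟩, rfl⟩, _, h, rfl⟩
    · rw [encode_cons, mem_mul] at h
      obtain ⟨x, hx, y, hy, hxy⟩ := h
      obtain ⟨b, hb, rfl⟩ := mem_markedFiber.1 hx
      refine ⟨φ (FreeMonoid.of a) * t, f, ?_⟩
      rw [encode_cons, mem_mul]
      refine ⟨(a :: b) ++ [c], mem_markedFiber.2 ⟨a :: b, ⟨?_, ?_⟩, rfl⟩, y, hy, ?_⟩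
      · intro z hz
        rcases List.mem_cons.1 hz with rfl | hz
        exacts [ha, hb.1 z hz]
      · rw [FreeMonoid.ofList_cons, map_mul, hb.2]
      · simpa using hxy

/-- The words over `B` ending in `c` with image `r`. -/
def fiberEndingIn (φ : FreeMonoid α →* M) (B : Set α) (c : α) (r : M) : Language α :=
  {w | ∃ u, w = u ++ [c] ∧ w ∈ fiberOver φ B r}

/-- The nonempty words `t :: f` over `M` such that `t * x = r`, where `x` is the value of `f` in
the local divisor at `m`. -/
def sandwichFiber (m r : M) : Language M :=
  biUnion {p : M × LocalDivisor m | p.1 * p.2.val = r}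
    fun p => {[p.1]} * fiberOver (LocalDivisor.sandwich m) Set.univ p.2

/-- The first letter stays apart because no c precedes the first block; its own marker is the φ(c)
that the tail needs. -/
theorem cons_mem_sandwichFiber {m r t : M} {f : List M} :
    t :: f ∈ sandwichFiber m r ↔
      t * (LocalDivisor.sandwich m (FreeMonoid.ofList f)).val = r := by
  constructor
  · rintro ⟨⟨t', n⟩, hp, hw⟩
    obtain ⟨_, rfl, g, hg, h⟩ := mem_mul.1 hw
    obtain ⟨rfl, rfl⟩ := List.cons.inj h
    exact (congrArg (fun x => t' * LocalDivisor.val x) hg.2).trans hp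
  · intro h
    exact ⟨(t, _), h, [t], rfl, f, ⟨fun _ _ => trivial, rfl⟩, rfl⟩

theorem exists_cons_of_mem_sandwichFiber {m r : M} {f : List M} (hf : f ∈ sandwichFiber m r) :
    ∃ t g, f = t :: g := by
  obtain ⟨⟨t, n⟩, -, hw⟩ := hf
  obtain ⟨_, rfl, g, -, rfl⟩ := mem_mul.1 hw
  exact ⟨t, g, rfl⟩

theorem isExpressible_sandwichFiber [Finite M] {m : M}
    (hm : ∀ n, (fiberOver (LocalDivisor.sandwich m) Set.univ n).IsExpressible
      (LocalDivisor.sandwich m)) (r : M) :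
    (sandwichFiber m r).IsExpressible (LocalDivisor.sandwich m) := by
  refine isExpressible_biUnion _ _ (Set.toFinite _) _ (fun p => ?_) ?_
  · refine (isExpressible_singleton _ p.1).mul (hm p.2) ?_
    rintro _ rfl _ rfl q - q' - h
    exact ⟨rfl, List.append_cancel_left h⟩
  · rintro ⟨t, n⟩ ⟨t', n'⟩ w hw hw'
    obtain ⟨_, rfl, g, hg, rfl⟩ := mem_mul.1 hw
    obtain ⟨_, rfl, g', hg', h⟩ := mem_mul.1 hw'
    obtain ⟨rfl, rfl⟩ := List.cons.inj h
    exact Prod.ext rfl (hg.2.symm.trans hg'.2)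

theorem subst_sandwichFiber (φ : FreeMonoid α →* M) {B : Set α} {c : α} (hc : c ∉ B) (r : M) :
    subst (markedFiber φ B c) (sandwichFiber (φ (FreeMonoid.of c)) r) =
      fiberEndingIn φ (insert c B) c r := by
  have key : ∀ t f w, w ∈ encode (markedFiber φ B c) (t :: f) → φ (FreeMonoid.ofList w) =
      t * (LocalDivisor.sandwich (φ (FreeMonoid.of c)) (FreeMonoid.ofList f)).val := by
    intro t f w hw
    rw [encode_cons, mem_mul] at hw
    obtain ⟨a, ha, w, hw, rfl⟩ := hw
    obtain ⟨b, hb, rfl⟩ := mem_markedFiber.1 ha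
    rw [FreeMonoid.ofList_append, FreeMonoid.ofList_append, FreeMonoid.ofList_singleton,
      map_mul, map_mul, hb.2, mul_assoc, mul_map_eq_val_sandwich φ hw]
  ext w
  rw [mem_subst]
  constructor
  · rintro ⟨f, hf, hw⟩
    obtain ⟨t, g, rfl⟩ := exists_cons_of_mem_sandwichFiber hf
    obtain ⟨u, hu⟩ := (isMarked_markedFiber φ hc).exists_eq_append_marker (by simp) hw
    refine ⟨u, hu, forall_mem_of_mem_encode hw, ?_⟩
    rw [key t g w hw, cons_mem_sandwichFiber.1 hf]
  · rintro ⟨u, rfl, hu, rfl⟩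
    obtain ⟨t, f, h⟩ := exists_mem_encode_cons φ (u := u) (B := B) (c := c)
      fun a ha => hu a (by simp [ha])
    exact ⟨t :: f, cons_mem_sandwichFiber.2 (key t f _ h).symm, h⟩

theorem isExpressible_fiberEndingIn [Finite M] (φ : FreeMonoid α →* M) {B : Set α} {c : α}
    (hc : c ∉ B) (hB : ∀ t, (fiberOver φ B t).IsExpressible φ)
    (hm : ∀ n, (fiberOver (LocalDivisor.sandwich (φ (FreeMonoid.of c))) Set.univ n).IsExpressible
      (LocalDivisor.sandwich (φ (FreeMonoid.of c)))) (r : M) :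
    (fiberEndingIn φ (insert c B) c r).IsExpressible φ := by
  have hσ : ∀ t, (markedFiber φ B c t).IsExpressible φ := fun t =>
    (hB t).mul (isExpressible_singleton φ c) <| by
      rintro p - p' - _ rfl _ rfl h
      exact ⟨List.append_cancel_right h, rfl⟩
  choose σ hσ hσB using hσ
  have hσ' : (fun t => (σ t).matches') = markedFiber φ B c := funext hσB
  obtain ⟨E, hE, hEK⟩ := isExpressible_sandwichFiber hm r
  refine ⟨E.subst σ, hE.subst (c := c) (ι := LocalDivisor.val) hσ ?_ ?_, ?_⟩
  · rw [hσ']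
    exact isMarked_markedFiber φ hc
  · rw [hσ']
    exact fun f w hw => mul_map_eq_val_sandwich φ hw
  · rw [RegularExpression.matches'_subst, hσ', hEK, subst_sandwichFiber φ hc]

/-- Words avoiding c form one summand; the others are cut after their last c and sorted by the
images r, t of the two parts, with rt = s. -/
theorem isExpressible_fiberOver_insert [Finite M] (φ : FreeMonoid α →* M) {B : Set α} {c : α}
    (hc : c ∉ B) (hB : ∀ t, (fiberOver φ B t).IsExpressible φ)
    (hm : ∀ n, (fiberOver (LocalDivisor.sandwich (φ (FreeMonoid.of c))) Set.univ n).IsExpressible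
      (LocalDivisor.sandwich (φ (FreeMonoid.of c)))) (s : M) :
    (fiberOver φ (insert c B) s).IsExpressible φ := by
  have huniq : ∀ r r' t t' : M, ∀ p ∈ fiberEndingIn φ (insert c B) c r,
      ∀ p' ∈ fiberEndingIn φ (insert c B) c r', ∀ q ∈ fiberOver φ B t,
      ∀ q' ∈ fiberOver φ B t', p ++ q = p' ++ q' → p = p' ∧ q = q' := by
    rintro r r' t t' _ ⟨u, rfl, -⟩ _ ⟨u', rfl, -⟩ q hq q' hq' h
    obtain ⟨rfl, rfl⟩ := append_marker_inj_right (fun h => hc (hq.1 c h))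
      (fun h => hc (hq'.1 c h)) h
    exact ⟨rfl, rfl⟩
  have hU := isExpressible_biUnion φ {p : M × M | p.1 * p.2 = s} (Set.toFinite _)
    (fun p => fiberEndingIn φ (insert c B) c p.1 * fiberOver φ B p.2)
    (fun p => (isExpressible_fiberEndingIn φ hc hB hm p.1).mul (hB p.2) (huniq _ _ _ _)) (by
      rintro ⟨r, t⟩ ⟨r', t'⟩ w hw hw'
      obtain ⟨p, hp, q, hq, rfl⟩ := mem_mul.1 hw
      obtain ⟨p', hp', q', hq', h⟩ := mem_mul.1 hw'
      obtain ⟨rfl, rfl⟩ := huniq _ _ _ _ p' hp' p hp q' hq' q hq h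
      obtain ⟨_, -, -, rfl⟩ := hp
      obtain ⟨_, -, -, rfl⟩ := hp'
      exact Prod.ext rfl (hq.2.symm.trans hq'.2))
  convert (hB s).add hU ?_
  · ext w
    rw [mem_add, mem_biUnion]
    constructor
    · intro hw
      by_cases hcw : c ∈ w
      -- The first c of the reversed word is the last c of `w`.
      · obtain ⟨v, u, hvu, hcv⟩ := List.eq_append_cons_of_mem (List.mem_reverse.2 hcw)
        have hw' : w = u.reverse ++ [c] ++ v.reverse := by
          simpa using congrArg List.reverse hvu
        have hcv' : c ∉ v.reverse := by simpa using hcv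
        generalize u.reverse = u at hw'
        generalize v.reverse = v at hw' hcv'
        subst hw'
        refine Or.inr ⟨(φ (FreeMonoid.ofList (u ++ [c])), φ (FreeMonoid.ofList v)), ?_,
          append_mem_mul ⟨u, rfl, fun a ha => hw.1 a (List.mem_append_left _ ha), rfl⟩
            ⟨fun a ha => ?_, rfl⟩⟩
        · rw [Set.mem_ofPred_eq, ← map_mul, ← FreeMonoid.ofList_append]
          exact hw.2
        · exact (hw.1 a (by simp [ha])).resolve_left fun h => hcv' (h ▸ ha)
      · exact Or.inl ⟨fun a ha => (hw.1 a ha).resolve_left fun h => hcw (h ▸ ha), hw.2⟩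
    · rintro (hw | ⟨⟨r, t⟩, hrt, hw⟩)
      · exact ⟨fun a ha => Or.inr (hw.1 a ha), hw.2⟩
      · obtain ⟨p, ⟨_, -, hp⟩, q, hq, rfl⟩ := mem_mul.1 hw
        refine ⟨fun a ha => ?_, ?_⟩
        · rcases List.mem_append.1 ha with ha | ha
          exacts [hp.1 a ha, Or.inr (hq.1 a ha)]
        · rw [FreeMonoid.ofList_append, map_mul, hp.2, hq.2]
          exact hrt
  · rintro w ⟨hw, ⟨r, t⟩, -, hw'⟩
    obtain ⟨_, ⟨u, rfl, -⟩, q, -, rfl⟩ := mem_mul.1 hw'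
    exact hc (hw.1 c (by simp))

theorem isExpressible_fiberOver_of_localDivisor [Finite α] [Finite M] (φ : FreeMonoid α →* M)
    (hdiv : ∀ m : M, m ≠ 1 → ∀ n, (fiberOver (LocalDivisor.sandwich m) Set.univ n).IsExpressible
      (LocalDivisor.sandwich m)) (B : Set α) (s : M) :
    (fiberOver φ B s).IsExpressible φ := by
  induction h : B.ncard using Nat.strong_induction_on generalizing B s with
  | _ k ih =>
    subst h
    by_cases hB : ∀ a ∈ B, φ (FreeMonoid.of a) = 1
    · exact isExpressible_fiberOver_of_trivial φ hB s
    · push Not at hB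
      obtain ⟨c, hcB, hc⟩ := hB
      have := isExpressible_fiberOver_insert φ (B := B \ {c}) (c := c) (by simp)
        (fun t => ih _ (Set.ncard_sdiff_singleton_lt_of_mem hcB) _ t rfl) (hdiv _ hc) s
      rwa [Set.insert_sdiff_singleton, Set.insert_eq_of_mem hcB] at this

universe u

/-- The induction on |M| must range over all finite alphabets, as the local divisor comes with the
alphabet M. This change of alphabet also puts both types in one universe. -/
theorem isExpressible_fiberOver {M : Type u} [Monoid M] [Finite M] (hM : Monoid.IsAperiodic M)
    {α : Type u} [Finite α] (φ : FreeMonoid α →* M) (B : Set α) (s : M) :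
    (fiberOver φ B s).IsExpressible φ := by
  induction h : Nat.card M using Nat.strong_induction_on generalizing M α with
  | _ k ih =>
    subst h
    exact isExpressible_fiberOver_of_localDivisor φ (fun m hm n =>
      ih _ (LocalDivisor.card_lt hM hm) (LocalDivisor.isAperiodic hM) _ _ n rfl) B s

end Language

theorem mainTheorem2 {α : Type*} [Finite α] {M : Type*} [Monoid M] [Finite M]
    (hM : Monoid.IsAperiodic M) (φ : FreeMonoid α →* M) (s : M) :
    ∃ E : RegularExpression α,
      E.IsUnambiguous ∧ E.IsStabilising φ ∧ E.IsSDRegular ∧ E.lang = φ ⁻¹' {s} := by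
  -- One step is unrolled by hand: α and M may lie in different universes, whereas M and its local
  -- divisors share one.
  obtain ⟨E, hE, hEs⟩ := Language.isExpressible_fiberOver_of_localDivisor φ
    (fun m _ n => Language.isExpressible_fiberOver (LocalDivisor.isAperiodic hM)
      (LocalDivisor.sandwich m) Set.univ n) Set.univ s
  refine ⟨E, hE.isUnambiguous, hE.isStabilising, hE.isSDRegular, ?_⟩
  ext w
  change w.toList ∈ E.matches' ↔ φ w = s
  rw [hEs]
  exact ⟨And.right, fun h => ⟨fun _ _ => trivial, h⟩⟩
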